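/- **Theorem.** Let $A$ be a finite set of $n$ alternatives and let $\mathcal L(A)$ be the set of linear orders $a_1a_2\ldots a_n$ on $A$, written from best to worst. A set $\mathcal D\subseteq\mathcal L(A)$ is a *Condorcet domain* if, for every finite multiset of orders from $\mathcal D$, the strict majority relation ("more orders rank $x$ above $y$ than $y$ above $x$") is transitive. It is *Arrow's single-peaked* if for each triple $S\subseteq A$ of alternatives there is an axis (a linear order on $S$) with respect to which the restriction to $S$ of every order in $\mathcal D$ is single-peaked, i.e. has a peak from which preference decreases along the axis in both directions. A *generalised arrangement of pseudolines* $\mathbf g=\{L_a\}_{a\in A}$, with lines labelled by the alternatives, consists of graphs of continuous functions on $[0,1]$ in the strip $E=[0,1]\times\mathbb R$, such that no two lines meet on the boundary lines $\{0\}\times\mathbb R$ and $\{1\}\times\mathbb R$, any two lines meet in finitely many (possibly zero, one or several) points, they cross at each of these points, and no two distinct pairs of lines meet at the same point. The *chambers* of $\mathbf g$ are the connected components of $E\setminus\bigcup_{a\in A} L_a$; the *chamber set* of a chamber is the set of all $a\in A$ such that $L_a$ goes above it. Let $\mathcal D(\mathbf g)$ be the set of all linear orders $a_1a_2\ldots a_n\in\mathcal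 L(A)$ such that each of the sets $\emptyset,\{a_1\},\{a_1,a_2\},\ldots,\{a_1,\ldots,a_n\}$ is a chamber set of $\mathbf g$. Then every maximal Arrow's single-peaked Condorcet domain is representable by a generalised arrangement of pseudolines: if $\mathcal D\subseteq\mathcal L(A)$ is maximal with respect to inclusion among the Arrow's single-peaked Condorcet domains on $A$ (in particular, if $\mathcal D$ is a maximal Condorcet domain that is Arrow's single-peaked), then there is a generalised arrangement of pseudolines $\mathbf g$ with lines labelled by $A$ such that $\mathcal D=\mathcal D(\mathbf g)$. -/

import Mathlib

open Set Filter Topology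

/-- Linear orders `a₁a₂…aₙ` on the finite set `A` of alternatives (with `n = |A|`), written from the
best alternative to the worst: `v i` is the alternative in position `i`. -/
abbrev PrefOrder (A : Type*) [Fintype A] : Type _ := Fin (Fintype.card A) ≃ A

namespace PrefOrder

variable {A : Type*} [Fintype A]

/-- `x` comes before `y` in the linear order `v`, that is, `v` ranks `x` above `y`. -/
abbrev Prefers (v : PrefOrder A) (x y : A) : Prop := v.symm x < v.symm y

/-- The flag `(F₀, F₁, …, Fₙ)` of the order `a₁a₂…aₙ`, where `F_k = {a₁, …, a_k}`. -/
def flag (v : PrefOrder A) (k : Fin (Fintype.card A + 1)) : Set A :=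
  v '' {i | i.castSucc < k}

end PrefOrder

/-- The strict majority relation of a profile (a multiset of linear orders): more voters rank `x`
above `y` than `y` above `x`. -/
def StrictMajority {A : Type*} [Fintype A] (P : Multiset (PrefOrder A)) (x y : A) : Prop :=
  P.countP (fun v => v.Prefers y x) < P.countP (fun v => v.Prefers x y)

/-- Condorcet domains: aggregating any multiset of orders of the domain by majority voting does not
lead to intransitivity. -/
def IsCondorcetDomain {A : Type*} [Fintype A] (D : Set (PrefOrder A)) : Prop :=
  ∀ P : Multiset (PrefOrder A), (∀ v ∈ P, v ∈ D) →
    ∀ x y z : A, StrictMajority P x y → StrictMajority P y z → StrictMajority P x z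

/-- The restriction of the domain `D` to the set `S` of alternatives is single-peaked: there is an
axis such that every order of `D` has, among the alternatives in `S`, a peak `p` from which
preference decreases along the axis in both directions. -/
def IsSinglePeakedOn {A : Type*} [Fintype A] (D : Set (PrefOrder A)) (S : Finset A) : Prop :=
  ∃ axis : PrefOrder A, ∀ v ∈ D, ∃ p ∈ S, ∀ x ∈ S, ∀ y ∈ S,
    (axis.symm p ≤ axis.symm x → axis.symm x < axis.symm y → v.Prefers x y) ∧
    (axis.symm x ≤ axis.symm p → axis.symm y < axis.symm x → v.Prefers x y)

/-- Arrow's single-peaked domains: the restriction to every triple of alternatives is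
single-peaked. -/
def IsArrowSinglePeaked {A : Type*} [Fintype A] (D : Set (PrefOrder A)) : Prop :=
  ∀ S : Finset A, S.card = 3 → IsSinglePeakedOn D S

/-- Generalised (simple, labelled) arrangements of pseudolines with lines labelled by `A`. The strip
between the vertical lines `L` and `R` is `[0, 1] × ℝ`, and the pseudoline with label `a` is the
graph of `line a` over `[0, 1]`. Two pseudolines cross finitely often, possibly never, strictly
between `L` and `R`. -/
structure GeneralisedArrangement (A : Type*) where
  line : A → ℝ → ℝ
  continuousOn_line : ∀ a, ContinuousOn (line a) (Icc 0 1)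
  /-- No two pseudolines meet on `L`. -/
  left_ne : ∀ a b, a ≠ b → line a 0 ≠ line b 0
  /-- No two pseudolines meet on `R`. -/
  right_ne : ∀ a b, a ≠ b → line a 1 ≠ line b 1
  finite_inter : ∀ a b, a ≠ b → {t ∈ Icc (0 : ℝ) 1 | line a t = line b t}.Finite
  /-- At every common point the two pseudolines cross. -/
  crossing : ∀ a b, a ≠ b → ∀ t ∈ Icc (0 : ℝ) 1, line a t = line b t →
    ((∀ᶠ s in 𝓝[<] t, line a s < line b s) ∧ (∀ᶠ s in 𝓝[>] t, line b s < line a s)) ∨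
    ((∀ᶠ s in 𝓝[<] t, line b s < line a s) ∧ (∀ᶠ s in 𝓝[>] t, line a s < line b s))
  /-- No two distinct pairs of pseudolines meet at the same point. -/
  simple : ∀ a b c d, a ≠ b → c ≠ d → ∀ t ∈ Icc (0 : ℝ) 1,
    line a t = line b t → line c t = line d t → line a t = line c t → s(a, b) = s(c, d)

namespace GeneralisedArrangement

variable {A : Type*}

/-- The strip `E` without the pseudolines. -/
def offLines (g : GeneralisedArrangement A) : Set (ℝ × ℝ) :=
  (Icc (0 : ℝ) 1 ×ˢ univ) \ ⋃ a, {p | p.2 = g.line a p.1}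

/-- Chambers are the connected components of the strip without the pseudolines. -/
def IsChamber (g : GeneralisedArrangement A) (C : Set (ℝ × ℝ)) : Prop :=
  ∃ p ∈ g.offLines, C = connectedComponentIn g.offLines p

/-- The label of a chamber: the set of lines that go above it. -/
def label (g : GeneralisedArrangement A) (C : Set (ℝ × ℝ)) : Set A :=
  {a | ∀ p ∈ C, p.2 < g.line a p.1}

/-- The chamber sets, i.e. the labels of the chambers. -/
def chamberSets (g : GeneralisedArrangement A) : Set (Set A) :=
  {X | ∃ C, g.IsChamber C ∧ X = g.label C}

/-- The domain of the linear orders that correspond to the flags of chamber sets. -/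
def domain [Fintype A] (g : GeneralisedArrangement A) : Set (PrefOrder A) :=
  {v | ∀ k, v.flag k ∈ g.chamberSets}

end GeneralisedArrangement

/-!
A triple of alternatives is single-peaked for some axis exactly when one of the three, the middle of
the axis, is never ranked last. Such a condition on every triple already forces the strict majority
relation to be transitive (`IsArrowSinglePeaked.isCondorcetDomain`), so a maximal domain `D` contains
every order all of whose last places on triples occur in `D` already, i.e. `D` is saturated
(`isSaturated_of_maximal`).

A saturated domain is connected under exchanges of neighbours (`IsSaturated.reachable_of_agree`): an
initial segment of an order of `D` can be rearranged in the way any other order of `D` ranks it, so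
if `a` and `b` can both come last in an initial segment, then both `… b a` and `… a b` can be
continued by the same tail. Hence some walk of single exchanges runs through all of `D`. Letting the
height of a line follow minus its position, linearly along each step of the walk, each exchange
becomes one crossing of one pair of lines, and this is a generalised arrangement
(`GeneralisedArrangement.ofWalk`). A pair of lines may cross several times, which is harmless.

The label of a chamber is the set of lines above any one of its points. Over the moment at which the
walk is at `v` the labels are the sets of the flag of `v`, so `D` is contained in the domain of the
arrangement. Conversely, every label is an initial segment of some order of the walk; so if `v` is in
the domain of the arrangement and ranks `z` below `x` and `y`, then an order of `D` does so as well,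
and `v ∈ D` by saturation.
-/

/-! ### Never-last alternatives -/

section NeverLast

variable {A : Type*} [Fintype A]

/-- Three alternatives can be listed in the way a given order ranks them. -/
theorem exists_lt_lt_of_card_eq_three {S : Finset A} (hS : S.card = 3) (v : PrefOrder A) :
    ∃ x ∈ S, ∃ m ∈ S, ∃ z ∈ S, v.Prefers x m ∧ v.Prefers m z := by
  classical
  obtain ⟨a, b, c, hab, hac, hbc, rfl⟩ := Finset.card_eq_three.1 hS
  have h1 : v.symm a ≠ v.symm b := v.symm.injective.ne hab
  have h2 : v.symm a ≠ v.symm c := v.symm.injective.ne hac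
  have h3 : v.symm b ≠ v.symm c := v.symm.injective.ne hbc
  simp only [PrefOrder.Prefers, Finset.mem_insert, Finset.mem_singleton, exists_eq_or_imp,
    exists_eq_left]
  rcases lt_or_gt_of_ne h1 with h1 | h1 <;> rcases lt_or_gt_of_ne h2 with h2 | h2 <;>
    rcases lt_or_gt_of_ne h3 with h3 | h3 <;> simp [*]

/-- The middle alternative of the axis is never the last one. -/
theorem IsSinglePeakedOn.exists_never_last {D : Set (PrefOrder A)} {S : Finset A}
    (hS : S.card = 3) (h : IsSinglePeakedOn D S) :
    ∃ m ∈ S, ∀ v ∈ D, ∃ x ∈ S, v.Prefers m x := by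
  obtain ⟨axis, h⟩ := h
  obtain ⟨x, hx, m, hm, z, hz, hxm, hmz⟩ := exists_lt_lt_of_card_eq_three hS axis
  refine ⟨m, hm, fun v hv => ?_⟩
  obtain ⟨p, hp, hpeak⟩ := h v hv
  rcases le_total (axis.symm p) (axis.symm m) with hpm | hpm
  · exact ⟨z, hz, (hpeak m hm z hz).1 hpm hmz⟩
  · exact ⟨x, hx, (hpeak m hm x hx).2 hpm hxm⟩

/-- An axis with the never-last alternative in the middle makes the triple single-peaked. -/
theorem isSinglePeakedOn_of_never_last {D : Set (PrefOrder A)} {S : Finset A}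
    (hS : S.card = 3) {m : A} (hm : m ∈ S) (h : ∀ v ∈ D, ∃ x ∈ S, v.Prefers m x) :
    IsSinglePeakedOn D S := by
  classical
  let e : PrefOrder A := (Fintype.equivFin A).symm
  obtain ⟨x, hx, c, hc, z, hz, hxc, hcz⟩ := exists_lt_lt_of_card_eq_three hS e
  have hxc' : x ≠ c := by rintro rfl; exact lt_irrefl _ hxc
  have hcz' : c ≠ z := by rintro rfl; exact lt_irrefl _ hcz
  have hxz' : x ≠ z := by rintro rfl; exact lt_asymm hxc hcz
  have hSe : S = {x, c, z} := by
    refine (Finset.eq_of_subset_of_card_le ?_ ?_).symm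
    · intro y hy
      simp only [Finset.mem_insert, Finset.mem_singleton] at hy
      rcases hy with rfl | rfl | rfl <;> assumption
    · rw [hS, Finset.card_eq_three.2 ⟨x, c, z, hxc', hxz', hcz', rfl⟩]
  -- Exchanging `m` with the middle alternative `c` gives an axis with `m` in the middle.
  obtain ⟨axis, x', z', hS', hx'm, hmz'⟩ : ∃ (axis : PrefOrder A) (x' z' : A),
      S = {x', m, z'} ∧ axis.Prefers x' m ∧ axis.Prefers m z' := by
    refine ⟨e.trans (Equiv.swap m c), Equiv.swap m c x, Equiv.swap m c z, ?_, ?_, ?_⟩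
    · rw [hSe] at hm ⊢
      simp only [Finset.mem_insert, Finset.mem_singleton] at hm
      rcases hm with rfl | rfl | rfl
      · rw [Equiv.swap_apply_left, Equiv.swap_apply_of_ne_of_ne hxz'.symm hcz'.symm,
          Finset.insert_comm]
      · simp
      · rw [Equiv.swap_apply_left, Equiv.swap_apply_of_ne_of_ne hxz' hxc']
        ext y; simp only [Finset.mem_insert, Finset.mem_singleton]; tauto
    · simpa [PrefOrder.Prefers] using hxc
    · simpa [PrefOrder.Prefers] using hcz
  subst hS'
  refine ⟨axis, fun v hv => ?_⟩
  obtain ⟨y, hy, hmy⟩ := h v hv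
  simp only [PrefOrder.Prefers, Finset.mem_insert, Finset.mem_singleton] at *
  have hbot : v.symm m < v.symm x' ∨ v.symm m < v.symm z' := by
    rcases hy with rfl | rfl | rfl
    · exact .inl hmy
    · exact absurd hmy (lt_irrefl _)
    · exact .inr hmy
  -- The peak is the alternative that `v` ranks first.
  by_cases h1 : v.symm x' < v.symm m
  · refine ⟨x', .inl rfl, ?_⟩
    rintro a (rfl | rfl | rfl) b (rfl | rfl | rfl) <;> constructor <;> intros <;> omega
  by_cases h2 : v.symm z' < v.symm m
  · refine ⟨z', .inr (.inr rfl), ?_⟩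
    rintro a (rfl | rfl | rfl) b (rfl | rfl | rfl) <;> constructor <;> intros <;> omega
  · have h3 : v.symm m ≠ v.symm x' := fun h => hx'm.ne (congrArg axis.symm (v.symm.injective h).symm)
    have h4 : v.symm m ≠ v.symm z' := fun h => hmz'.ne (congrArg axis.symm (v.symm.injective h))
    refine ⟨m, .inr (.inl rfl), ?_⟩
    rintro a (rfl | rfl | rfl) b (rfl | rfl | rfl) <;> constructor <;> intros <;> omega

theorem Multiset.countP_le_countP_of_imp {α : Type*} {p q : α → Prop} [DecidablePred p]
    [DecidablePred q] (P : Multiset α) (h : ∀ a ∈ P, p a → q a) : P.countP p ≤ P.countP q := by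
  induction P using Quot.inductionOn with
  | h l => simpa using List.countP_mono_left (by simpa using h)

/-- If one of three alternatives is never last, then the strict majority relation on them is
transitive: depending on which alternative it is, one of the two given majorities is contained in
the required one, or the two are disjoint. -/
theorem IsArrowSinglePeaked.isCondorcetDomain {D : Set (PrefOrder A)}
    (hD : IsArrowSinglePeaked D) : IsCondorcetDomain D := by
  classical
  intro P hP x y z hxy hyz
  rcases eq_or_ne x y with rfl | hne1
  · exact absurd hxy (lt_irrefl _)
  rcases eq_or_ne y z with rfl | hne2
  · exact absurd hyz (lt_irrefl _)
  rcases eq_or_ne x z with rfl | hne3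
  · exact absurd hxy (lt_asymm hyz)
  have hS : ({x, y, z} : Finset A).card = 3 := Finset.card_eq_three.2 ⟨x, y, z, hne1, hne3, hne2, rfl⟩
  obtain ⟨m, hm, hlast⟩ := (hD _ hS).exists_never_last hS
  simp only [Finset.mem_insert, Finset.mem_singleton, exists_eq_or_imp, exists_eq_left] at hm hlast
  simp only [StrictMajority, PrefOrder.Prefers] at *
  have key : ∀ {a b c d : A}, (∀ v ∈ D, v.symm a < v.symm b → v.symm c < v.symm d) →
      P.countP (fun v => v.symm a < v.symm b) ≤ P.countP (fun v => v.symm c < v.symm d) :=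
    fun h => Multiset.countP_le_countP_of_imp P fun v hv => h v (hP v hv)
  have inj : ∀ (v : PrefOrder A) {a b : A}, a ≠ b → v.symm a ≠ v.symm b :=
    fun v _ _ => v.symm.injective.ne
  rcases hm with rfl | rfl | rfl
  · have h1 := key (a := y) (b := z) (c := m) (d := z) fun v hv h => by
      have := hlast v hv; omega
    have h2 := key (a := z) (b := m) (c := z) (d := y) fun v hv h => by
      have := hlast v hv; omega
    omega
  · have h1 := key (a := x) (b := m) (c := x) (d := z) fun v hv h => by
      have := hlast v hv; omega
    have h2 := key (a := z) (b := x) (c := m) (d := x) fun v hv h => by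
      have := hlast v hv; omega
    omega
  · have h1 := key (a := x) (b := y) (c := m) (d := y) fun v hv h => by
      have := hlast v hv; omega
    have h2 := key (a := y) (b := m) (c := y) (d := x) fun v hv h => by
      have := hlast v hv; omega
    omega

end NeverLast

/-! ### Saturated domains -/

section Saturated

variable {A : Type*} [Fintype A]

/-- A domain is saturated if it contains every order `v` such that, whenever `v` ranks `z` below
`x` and `y`, some order of the domain does so too. -/
def IsSaturated (D : Set (PrefOrder A)) : Prop :=
  ∀ v : PrefOrder A, (∀ x y z, v.Prefers x z → v.Prefers y z →
    ∃ w ∈ D, w.Prefers x z ∧ w.Prefers y z) → v ∈ D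

/-- Adding an order whose last alternatives on triples already occur keeps every never-last
alternative. -/
theorem isSaturated_of_maximal {D : Set (PrefOrder A)}
    (hD : Maximal (fun D' : Set (PrefOrder A) => IsCondorcetDomain D' ∧ IsArrowSinglePeaked D') D) :
    IsSaturated D := by
  classical
  intro v hv
  have hins : IsArrowSinglePeaked (insert v D) := by
    intro S hS
    obtain ⟨m, hm, hlast⟩ := (hD.prop.2 S hS).exists_never_last hS
    refine isSinglePeakedOn_of_never_last hS hm ?_
    rintro w (rfl | hw)
    · by_contra! hcon
      have hcard : (S.erase m).card = 2 := by rw [Finset.card_erase_of_mem hm, hS]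
      obtain ⟨x, y, hxy, hSe⟩ := Finset.card_eq_two.1 hcard
      have hx : x ∈ S.erase m := by simp [hSe]
      have hy : y ∈ S.erase m := by simp [hSe]
      have before : ∀ a ∈ S.erase m, w.Prefers a m := fun a ha =>
        lt_of_le_of_ne (hcon a (Finset.mem_of_mem_erase ha))
          (w.symm.injective.ne (Finset.ne_of_mem_erase ha))
      obtain ⟨u, hu, hxm, hym⟩ := hv x y m (before x hx) (before y hy)
      obtain ⟨c, hc, hmc⟩ := hlast u hu
      rcases eq_or_ne c m with rfl | hcm
      · exact lt_irrefl _ hmc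
      have hc' : c ∈ S.erase m := Finset.mem_erase.2 ⟨hcm, hc⟩
      rw [hSe, Finset.mem_insert, Finset.mem_singleton] at hc'
      rcases hc' with rfl | rfl
      · exact lt_asymm hmc hxm
      · exact lt_asymm hmc hym
    · exact hlast w hw
  exact hD.le_of_ge ⟨hins.isCondorcetDomain, hins⟩ (subset_insert v D) (mem_insert v D)

end Saturated

/-! ### Splicing and exchanging -/

namespace PrefOrder

variable {A : Type*} [Fintype A]

theorem perm_apply_eq_card {n : ℕ} (τ : Equiv.Perm (Fin n)) (j : Fin n) :
    (τ j : ℕ) = (Finset.univ.filter fun i => τ i < τ j).card := by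
  have : (Finset.univ.filter fun i => τ i < τ j) = (Finset.Iio (τ j)).map τ.symm.toEmbedding := by
    ext i; simp
  rw [this, Finset.card_map, Fin.card_Iio]

/-- The first `k` alternatives of `v` can be rearranged in the way they are ordered by `u`. -/
theorem exists_splice (u v : PrefOrder A) (k : ℕ) :
    ∃ w : PrefOrder A, (∀ i : Fin (Fintype.card A), k ≤ i → w i = v i) ∧
      ∀ x y, (v.symm x : ℕ) < k → (v.symm y : ℕ) < k → (w.Prefers x y ↔ u.Prefers x y) := by
  let f : Fin (Fintype.card A) → ℕ := fun j =>
    if (j : ℕ) < k then u.symm (v j) else Fintype.card A + j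
  have hf : Function.Injective f := by
    intro i j hij
    simp only [f] at hij
    have hi := (u.symm (v i)).2
    have hj := (u.symm (v j)).2
    split_ifs at hij
    · exact v.injective (u.symm.injective (Fin.ext hij))
    · omega
    · omega
    · exact Fin.ext (by omega)
  let σ := Tuple.sort f
  have hmono : StrictMono (f ∘ σ) :=
    (Tuple.monotone_sort f).strictMono_of_injective (hf.comp σ.injective)
  have hσ : ∀ i j, σ.symm i < σ.symm j ↔ f i < f j := fun i j => by
    rw [← hmono.lt_iff_lt]; simp
  have hfix : ∀ j : Fin (Fintype.card A), k ≤ j → σ.symm j = j := by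
    intro j hj
    apply Fin.ext
    have hset : (Finset.univ.filter fun i => σ.symm i < σ.symm j) = Finset.Iio j := by
      ext i
      simp only [Finset.mem_filter, Finset.mem_univ, true_and, Finset.mem_Iio, hσ, f]
      have hi := (u.symm (v i)).2
      rw [if_neg (by omega : ¬ (j : ℕ) < k)]
      split_ifs <;> omega
    rw [perm_apply_eq_card, hset, Fin.card_Iio]
  refine ⟨σ.trans v, fun i hi => ?_, fun x y hx hy => ?_⟩
  · have : σ i = i := by rw [← Equiv.eq_symm_apply, hfix i hi]
    simp [this]
  · simp only [Prefers, Equiv.symm_trans_apply, hσ, f, hx, hy, if_true, Equiv.apply_symm_apply,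
      Fin.val_fin_lt]

/-- Orders that agree from position `k` on have the same set of first `k` alternatives. -/
theorem symm_lt_iff_of_agree {v w : PrefOrder A} {k : ℕ}
    (h : ∀ i : Fin (Fintype.card A), k ≤ i → v i = w i) (x : A) :
    (v.symm x : ℕ) < k ↔ (w.symm x : ℕ) < k := by
  constructor
  · intro hx
    by_contra! hw
    have : v.symm x = w.symm x := by rw [Equiv.symm_apply_eq, h _ hw, Equiv.apply_symm_apply]
    omega
  · intro hx
    by_contra! hv
    have : w.symm x = v.symm x := by rw [Equiv.symm_apply_eq, ← h _ hv, Equiv.apply_symm_apply]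
    omega

/-- Exchanging the neighbours in positions `i` and `i'` reverses only their own comparison. -/
theorem prefers_of_prefers_swap {v : PrefOrder A} {i i' : Fin (Fintype.card A)}
    (hi : (i' : ℕ) = i + 1) {x y : A}
    (h : Prefers ((Equiv.swap i i').trans v) x y) :
    v.Prefers x y ∨ (x = v i' ∧ y = v i) := by
  simp only [Prefers, Equiv.symm_trans_apply, Equiv.symm_swap] at h
  rw [← Equiv.symm_apply_eq, ← Equiv.symm_apply_eq, Prefers]
  generalize v.symm x = p at *
  generalize v.symm y = q at *
  simp only [Equiv.swap_apply_def] at h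
  split_ifs at h <;> omega

/-- The graph on a domain whose edges join the orders that differ by an exchange of two
neighbours. -/
def swapGraph (D : Set (PrefOrder A)) : SimpleGraph D where
  Adj v w := ∃ i i' : Fin (Fintype.card A), (i' : ℕ) = i + 1 ∧
    (w : PrefOrder A) = (Equiv.swap i i').trans v
  symm := ⟨by
    rintro v w ⟨i, i', hi, hw⟩
    exact ⟨i, i', hi, by rw [hw, ← Equiv.trans_assoc, Equiv.swap_swap, Equiv.refl_trans]⟩⟩
  loopless := ⟨by
    rintro v ⟨i, i', hi, hw⟩
    have h : v.1 i = v.1 i' := by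
      conv_lhs => rw [hw]
      simp
    have := v.1.injective h
    omega⟩

end PrefOrder

/-! ### Connectedness of saturated domains -/

section Connected

open PrefOrder

variable {A : Type*} [Fintype A] {D : Set (PrefOrder A)}

theorem IsSaturated.mem_of_splice (hD : IsSaturated D) {u v w : PrefOrder A} (hu : u ∈ D)
    (hv : v ∈ D) {k : ℕ} (hagree : ∀ i : Fin (Fintype.card A), k ≤ i → w i = v i)
    (hw : ∀ x y, (v.symm x : ℕ) < k → (v.symm y : ℕ) < k → (w.Prefers x y ↔ u.Prefers x y)) :
    w ∈ D := by
  refine hD w fun x y z hx hy => ?_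
  rcases lt_or_ge (w.symm z : ℕ) k with hz | hz
  · have lt : ∀ x, w.Prefers x z → u.Prefers x z := fun x hx =>
      (hw x z ((symm_lt_iff_of_agree hagree x).1 (lt_trans hx hz))
        ((symm_lt_iff_of_agree hagree z).1 hz)).1 hx
    exact ⟨u, hu, lt x hx, lt y hy⟩
  · have hzeq : v.symm z = w.symm z := by
      rw [Equiv.symm_apply_eq, ← hagree _ hz, Equiv.apply_symm_apply]
    have lt : ∀ x, w.Prefers x z → v.Prefers x z := fun x hx => by
      rw [Prefers, hzeq]
      exact (symm_lt_iff_of_agree (fun i hi => hagree i (hz.trans hi)) x).1 hx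
    exact ⟨v, hv, lt x hx, lt y hy⟩

/-- If `a ≠ b` both occur in position `k` after the same rest, then the first `k` places of an order
ending in `a` can be rearranged within the domain so that `b` comes right before `a`; the exchange
of `a` and `b` then stays in the domain, since `b` is last in that initial segment for another
order. -/
theorem IsSaturated.reachable_of_agree (hD : IsSaturated D) (k : ℕ) : ∀ v w : D,
    (∀ i : Fin (Fintype.card A), k ≤ i → v.1 i = w.1 i) → (swapGraph D).Reachable v w := by
  induction k with
  | zero =>
    intro v w h
    rw [Subtype.ext (Equiv.ext fun i => h i (Nat.zero_le _))]
  | succ k ih =>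
    intro v w h
    by_cases hk : ∃ i : Fin (Fintype.card A), (i : ℕ) = k ∧ v.1 i ≠ w.1 i
    swap
    · push Not at hk
      refine ih v w fun i hi => ?_
      rcases hi.eq_or_lt with hi | hi
      · exact hk i hi.symm
      · exact h i hi
    obtain ⟨i', hi', hne⟩ := hk
    have hbk : (v.1.symm (w.1 i') : ℕ) < k := by
      have h1 := (symm_lt_iff_of_agree h (w.1 i')).2 (by simp; omega)
      have h2 : v.1.symm (w.1 i') ≠ i' := by
        rw [Ne, Equiv.symm_apply_eq]; exact hne.symm
      omega
    obtain ⟨i, hi⟩ : ∃ i : Fin (Fintype.card A), (i' : ℕ) = i + 1 :=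
      ⟨⟨k - 1, by omega⟩, by simp only; omega⟩
    obtain ⟨v₁, hv₁, hpref⟩ := exists_splice w.1 v.1 k
    have hv₁D : v₁ ∈ D := hD.mem_of_splice w.2 v.2 hv₁ hpref
    have hv₁i' : v₁ i' = v.1 i' := hv₁ i' hi'.ge
    have hv₁i : v₁ i = w.1 i' := by
      by_contra hc
      have h1 : (v.1.symm (v₁ i) : ℕ) < k :=
        (symm_lt_iff_of_agree hv₁ _).1 (by simp; omega)
      have h2 : w.1.Prefers (v₁ i) (w.1 i') := by
        have h3 := (symm_lt_iff_of_agree h (v₁ i)).1 (by omega)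
        have h4 : w.1.symm (v₁ i) ≠ i' := by rwa [Ne, Equiv.symm_apply_eq]
        simp only [Prefers, Equiv.symm_apply_apply]
        omega
      have h5 := (hpref _ _ h1 hbk).2 h2
      have h6 := (symm_lt_iff_of_agree hv₁ (w.1 i')).2 hbk
      simp only [Prefers, Equiv.symm_apply_apply] at h5
      omega
    let v₂ : PrefOrder A := (Equiv.swap i i').trans v₁
    have hagree : ∀ j : Fin (Fintype.card A), k ≤ j → v₂ j = w.1 j := by
      intro j hj
      rcases eq_or_ne j i' with rfl | hji
      · simp [v₂, hv₁i]
      · have : j ≠ i := by rintro rfl; omega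
        have : (j : ℕ) ≠ i' := fun h => hji (Fin.ext h)
        simp only [v₂, Equiv.trans_apply]
        rw [Equiv.swap_apply_of_ne_of_ne ‹_› hji, hv₁ j hj, h j (by omega)]
    have hv₂D : v₂ ∈ D := by
      refine hD v₂ fun x y z hx hy => ?_
      by_cases hz : z = w.1 i'
      · have lt : ∀ x, v₂.Prefers x z → w.1.Prefers x z := by
          intro x hx
          have hz2 : v₂.symm z = i' := by
            rw [Equiv.symm_apply_eq, hagree i' hi'.ge, hz]
          have h1 : (v₂.symm x : ℕ) < k := by rw [Prefers, hz2] at hx; omega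
          have h2 := (symm_lt_iff_of_agree hagree x).1 h1
          rw [hz, Prefers, Equiv.symm_apply_apply]
          omega
        exact ⟨w.1, w.2, lt x hx, lt y hy⟩
      · have lt : ∀ x, v₂.Prefers x z → v₁.Prefers x z := fun x hx =>
          (prefers_of_prefers_swap hi hx).resolve_right fun h => hz (h.2.trans hv₁i)
        exact ⟨v₁, hv₁D, lt x hx, lt y hy⟩
    refine (ih v ⟨v₁, hv₁D⟩ fun j hj => (hv₁ j hj).symm).trans ?_
    have hadj : (swapGraph D).Adj ⟨v₁, hv₁D⟩ ⟨v₂, hv₂D⟩ := ⟨i, i', hi, rfl⟩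
    exact hadj.reachable.trans (ih ⟨v₂, hv₂D⟩ w hagree)

theorem IsSaturated.preconnected_swapGraph (hD : IsSaturated D) : (swapGraph D).Preconnected :=
  fun v w => hD.reachable_of_agree (Fintype.card A) v w fun i hi => absurd i.2 (not_lt.2 hi)

end Connected

/-- A finite set of vertices of a preconnected graph can be visited by one walk. -/
theorem SimpleGraph.Preconnected.exists_walk_forall_mem_support {V : Type*} {G : SimpleGraph V}
    (hG : G.Preconnected) (u : V) (T : Finset V) :
    ∃ (v : V) (p : G.Walk u v), ∀ x ∈ T, x ∈ p.support := by
  classical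
  induction T using Finset.induction_on with
  | empty => exact ⟨u, .nil, by simp⟩
  | insert x T _ ih =>
    obtain ⟨v, p, hp⟩ := ih
    obtain ⟨q⟩ := hG v x
    refine ⟨x, p.append q, fun y hy => ?_⟩
    rw [SimpleGraph.Walk.mem_support_append_iff]
    rcases Finset.mem_insert.1 hy with rfl | hy
    · exact .inr q.end_mem_support
    · exact .inl (hp y hy)

/-! ### Interpolating a walk of orders -/

section Strand

open PrefOrder

variable {A : Type*} [Fintype A]

/-- The height at time `s` of the strand of `a`, which has height `-(position of a in w j)` at the
integer times `j ≤ N` and is linear between them. -/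
noncomputable def strand (w : ℕ → PrefOrder A) (N : ℕ) (a : A) (s : ℝ) : ℝ :=
  -(((w 0).symm a : ℕ) : ℝ) + ∑ j ∈ Finset.range N,
    ((((w j).symm a : ℕ) : ℝ) - (((w (j + 1)).symm a : ℕ) : ℝ)) * max 0 (min 1 (s - j))

theorem continuous_strand (w : ℕ → PrefOrder A) (N : ℕ) (a : A) : Continuous (strand w N a) := by
  unfold strand
  fun_prop

theorem strand_of_le (w : ℕ → PrefOrder A) (N : ℕ) (a : A) {s : ℝ} (hs : N ≤ s) :
    strand w N a s = -(((w N).symm a : ℕ) : ℝ) := by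
  induction N with
  | zero => simp [strand]
  | succ N ih =>
    push_cast at hs
    have := ih (by linarith)
    unfold strand at this ⊢
    rw [Finset.sum_range_succ, ← add_assoc, this, min_eq_left (by linarith), max_eq_right zero_le_one]
    ring

theorem strand_eq (w : ℕ → PrefOrder A) {N j : ℕ} (hj : j < N) (a : A) {s : ℝ}
    (h0 : (j : ℝ) ≤ s) (h1 : s ≤ j + 1) :
    strand w N a s =
      -((1 - (s - j)) * (((w j).symm a : ℕ) : ℝ) + (s - j) * (((w (j + 1)).symm a : ℕ) : ℝ)) := by
  induction N, Nat.succ_le_of_lt hj using Nat.le_induction with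
  | base =>
    have := strand_of_le w j a h0
    unfold strand at this ⊢
    rw [Finset.sum_range_succ, ← add_assoc, this, min_eq_right (by linarith),
      max_eq_right (by linarith)]
    ring
  | succ N hN ih =>
    have hN' : (j : ℝ) + 1 ≤ N := by exact_mod_cast hN
    rw [← ih (Nat.lt_of_succ_le hN)]
    unfold strand
    rw [Finset.sum_range_succ, max_eq_left ((min_le_right _ _).trans (by linarith))]
    ring

theorem exists_unit_interval {N : ℕ} (hN : 0 < N) {s : ℝ} (h0 : 0 ≤ s) (h1 : s ≤ N) :
    ∃ j < N, (j : ℝ) ≤ s ∧ s ≤ j + 1 := by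
  rcases h1.eq_or_lt with rfl | h1
  · obtain ⟨M, rfl⟩ := Nat.exists_eq_succ_of_ne_zero hN.ne'
    exact ⟨M, by omega, by push_cast; linarith, by push_cast; linarith⟩
  · exact ⟨⌊s⌋₊, (Nat.floor_lt h0).2 h1, Nat.floor_le h0, (Nat.lt_floor_add_one s).le⟩

/-- The order `w` equals `v` or arises from it by exchanging two neighbours. -/
def IsLazySwap (v w : PrefOrder A) : Prop :=
  w = v ∨ ∃ i i' : Fin (Fintype.card A), (i' : ℕ) = i + 1 ∧ w = (Equiv.swap i i').trans v

/-- A comparison that a lazy swap reverses is that of the two exchanged neighbours. -/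
theorem IsLazySwap.prefers_or_exchanged {v w : PrefOrder A} (h : IsLazySwap v w) {a b : A}
    (hab : v.Prefers a b) : w.Prefers a b ∨ ((v.symm b : ℕ) = v.symm a + 1 ∧
      w.symm a = v.symm b ∧ w.symm b = v.symm a) := by
  rcases h with rfl | ⟨i, i', hi, rfl⟩
  · exact .inl hab
  · simp only [Prefers, Equiv.symm_trans_apply, Equiv.symm_swap] at hab ⊢
    generalize v.symm a = p at *
    generalize v.symm b = q at *
    simp only [Equiv.swap_apply_def]
    split_ifs <;> omega

/-- Strands that meet during a lazy swap do so halfway, and are the exchanged ones. -/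
theorem IsLazySwap.of_meet {v w : PrefOrder A} (h : IsLazySwap v w) {a b : A}
    (hab : v.Prefers a b) {τ : ℝ} (h0 : 0 ≤ τ) (h1 : τ ≤ 1)
    (heq : (1 - τ) * ((v.symm a : ℕ) : ℝ) + τ * ((w.symm a : ℕ) : ℝ) =
      (1 - τ) * ((v.symm b : ℕ) : ℝ) + τ * ((w.symm b : ℕ) : ℝ)) :
    τ = 1 / 2 ∧ (v.symm b : ℕ) = v.symm a + 1 ∧ w.symm a = v.symm b ∧ w.symm b = v.symm a := by
  rcases h.prefers_or_exchanged hab with hw | ⟨hb, hwa, hwb⟩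
  · have h2 : ((v.symm a : ℕ) : ℝ) + 1 ≤ ((v.symm b : ℕ) : ℝ) := by exact_mod_cast hab
    have h3 : ((w.symm a : ℕ) : ℝ) + 1 ≤ ((w.symm b : ℕ) : ℝ) := by exact_mod_cast hw
    nlinarith
  · refine ⟨?_, hb, hwa, hwb⟩
    rw [hwa, hwb, hb] at heq
    push_cast at heq
    linarith

/-- A lazy swap exchanges at most one pair of neighbours. -/
theorem IsLazySwap.unique {v w : PrefOrder A} (h : IsLazySwap v w) {a b c d : A}
    (hab : v.Prefers a b) (hab' : w.Prefers b a) (hcd : v.Prefers c d) (hcd' : w.Prefers d c) :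
    a = c ∧ b = d := by
  rcases h with rfl | ⟨i, i', hi, rfl⟩
  · exact absurd hab (lt_asymm hab')
  · have h1 := (prefers_of_prefers_swap hi hab').resolve_left (lt_asymm hab)
    have h2 := (prefers_of_prefers_swap hi hcd').resolve_left (lt_asymm hcd)
    exact ⟨h1.2.trans h2.2.symm, h1.1.trans h2.1.symm⟩

/-- At each time of a lazy swap the heights are weakly sorted by the nearer end of the swap. -/
theorem IsLazySwap.exists_sorted {v w : PrefOrder A} (h : IsLazySwap v w) {τ : ℝ} (h0 : 0 ≤ τ)
    (h1 : τ ≤ 1) : ∃ u : PrefOrder A, (u = v ∨ u = w) ∧ ∀ a b, u.Prefers a b →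
      (1 - τ) * ((v.symm a : ℕ) : ℝ) + τ * ((w.symm a : ℕ) : ℝ) ≤
        (1 - τ) * ((v.symm b : ℕ) : ℝ) + τ * ((w.symm b : ℕ) : ℝ) := by
  have key : ∀ a b, v.Prefers a b → w.Prefers a b →
      (1 - τ) * ((v.symm a : ℕ) : ℝ) + τ * ((w.symm a : ℕ) : ℝ) ≤
        (1 - τ) * ((v.symm b : ℕ) : ℝ) + τ * ((w.symm b : ℕ) : ℝ) := fun a b hv hw => by
    have h2 : ((v.symm a : ℕ) : ℝ) ≤ ((v.symm b : ℕ) : ℝ) := by exact_mod_cast hv.le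
    have h3 : ((w.symm a : ℕ) : ℝ) ≤ ((w.symm b : ℕ) : ℝ) := by exact_mod_cast hw.le
    have := sub_nonneg.2 h1
    gcongr
  rcases le_total τ (1 / 2) with hτ | hτ
  · refine ⟨v, .inl rfl, fun a b hab => ?_⟩
    rcases h.prefers_or_exchanged hab with hw | ⟨hb, hwa, hwb⟩
    · exact key a b hab hw
    · rw [hwa, hwb, hb]
      push_cast
      linarith
  · refine ⟨w, .inr rfl, fun a b hab => ?_⟩
    have hne : v.symm a ≠ v.symm b := v.symm.injective.ne (by rintro rfl; exact lt_irrefl _ hab)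
    rcases lt_or_gt_of_ne hne with hv | hv
    · exact key a b hv hab
    · rcases h.prefers_or_exchanged hv with hw | ⟨hb, hwa, hwb⟩
      · exact absurd hab (lt_asymm hw)
      · rw [hwa, hwb, hb]
        push_cast
        linarith

end Strand

/-! ### The arrangement of a walk -/

section OfWalk

open PrefOrder

variable {A : Type*} [Fintype A] {w : ℕ → PrefOrder A} {N : ℕ}

theorem exists_step {N : ℕ} (hN : 0 < N) {t : ℝ} (ht : t ∈ Icc (0 : ℝ) 1) :
    ∃ j < N, (j : ℝ) ≤ N * t ∧ N * t ≤ j + 1 :=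
  exists_unit_interval hN (mul_nonneg N.cast_nonneg ht.1)
    (mul_le_of_le_one_right N.cast_nonneg ht.2)

/-- Two strands meet only in the middle of a step of the walk that exchanges them. -/
theorem strand_meet (hw : ∀ j, IsLazySwap (w j) (w (j + 1))) {a b : A} {j : ℕ} (hj : j < N)
    {s : ℝ} (h0 : (j : ℝ) ≤ s) (h1 : s ≤ j + 1) (hab : (w j).Prefers a b)
    (heq : strand w N a s = strand w N b s) :
    s - j = 1 / 2 ∧ ((w j).symm b : ℕ) = (w j).symm a + 1 ∧
      (w (j + 1)).symm a = (w j).symm b ∧ (w (j + 1)).symm b = (w j).symm a := by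
  rw [strand_eq w hj a h0 h1, strand_eq w hj b h0 h1, neg_inj] at heq
  exact (hw j).of_meet hab (by linarith) (by linarith) heq

theorem PrefOrder.prefers_or_prefers (v : PrefOrder A) {a b : A} (h : a ≠ b) :
    v.Prefers a b ∨ v.Prefers b a :=
  lt_or_gt_of_ne (v.symm.injective.ne h)

theorem finite_strand_meet (hN : 0 < N) (hw : ∀ j, IsLazySwap (w j) (w (j + 1))) {a b : A}
    (hab : a ≠ b) : {t ∈ Icc (0 : ℝ) 1 | strand w N a (N * t) = strand w N b (N * t)}.Finite := by
  refine ((Finset.range N).finite_toSet.image fun j : ℕ => ((j : ℝ) + 1 / 2) / N).subset ?_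
  rintro t ⟨ht, heq⟩
  obtain ⟨j, hj, h0, h1⟩ := exists_step hN ht
  have hN' : (N : ℝ) ≠ 0 := by exact_mod_cast hN.ne'
  have hmid : (N : ℝ) * t - j = 1 / 2 := by
    rcases PrefOrder.prefers_or_prefers (w j) hab with h | h
    · exact (strand_meet hw hj h0 h1 h heq).1
    · exact (strand_meet hw hj h0 h1 h heq.symm).1
  refine ⟨j, by simpa using hj, ?_⟩
  simp only
  rw [div_eq_iff hN']
  linarith

theorem strand_crossing (hN : 0 < N) (hw : ∀ j, IsLazySwap (w j) (w (j + 1))) {a b : A} {t : ℝ}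
    {j : ℕ} (hj : j < N) (h0 : (j : ℝ) ≤ N * t) (h1 : N * t ≤ j + 1)
    (hab : (w j).Prefers a b) (heq : strand w N a (N * t) = strand w N b (N * t)) :
    (∀ᶠ s in 𝓝[<] t, strand w N b (N * s) < strand w N a (N * s)) ∧
      (∀ᶠ s in 𝓝[>] t, strand w N a (N * s) < strand w N b (N * s)) := by
  obtain ⟨hmid, hb, hwa, hwb⟩ := strand_meet hw hj h0 h1 hab heq
  have hN' : (0 : ℝ) < N := by exact_mod_cast hN
  have hdiff : ∀ s : ℝ, (j : ℝ) ≤ N * s → N * s ≤ j + 1 →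
      strand w N a (N * s) - strand w N b (N * s) = 2 * (N * t - N * s) := by
    intro s h0 h1
    rw [strand_eq w hj a h0 h1, strand_eq w hj b h0 h1, hwa, hwb, hb]
    push_cast
    linarith
  have hcont : ContinuousAt (fun s : ℝ => (N : ℝ) * s) t := by fun_prop
  have hl : ∀ᶠ s in 𝓝 t, (j : ℝ) < N * s := hcont.eventually (lt_mem_nhds (by linarith))
  have hr : ∀ᶠ s in 𝓝 t, (N : ℝ) * s < j + 1 := hcont.eventually (gt_mem_nhds (by linarith))
  constructor
  · filter_upwards [nhdsWithin_le_nhds hl, nhdsWithin_le_nhds hr, self_mem_nhdsWithin]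
      with s hl hr hs
    have := hdiff s hl.le hr.le
    have := mul_lt_mul_of_pos_left (mem_Iio.1 hs) hN'
    linarith
  · filter_upwards [nhdsWithin_le_nhds hl, nhdsWithin_le_nhds hr, self_mem_nhdsWithin]
      with s hl hr hs
    have := hdiff s hl.le hr.le
    have := mul_lt_mul_of_pos_left (mem_Ioi.1 hs) hN'
    linarith

theorem strand_simple (hN : 0 < N) (hw : ∀ j, IsLazySwap (w j) (w (j + 1))) {a b c d : A}
    (hab : a ≠ b) (hcd : c ≠ d) {t : ℝ} (ht : t ∈ Icc (0 : ℝ) 1)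
    (h₁ : strand w N a (N * t) = strand w N b (N * t))
    (h₂ : strand w N c (N * t) = strand w N d (N * t)) : s(a, b) = s(c, d) := by
  obtain ⟨j, hj, h0, h1⟩ := exists_step hN ht
  wlog hab' : (w j).Prefers a b generalizing a b
  · rw [Sym2.eq_swap]
    exact this hab.symm h₁.symm ((PrefOrder.prefers_or_prefers (w j) hab).resolve_left hab')
  wlog hcd' : (w j).Prefers c d generalizing c d
  · rw [Sym2.eq_swap (a := c)]
    exact this hcd.symm h₂.symm ((PrefOrder.prefers_or_prefers (w j) hcd).resolve_left hcd')
  obtain ⟨-, -, hwa, hwb⟩ := strand_meet hw hj h0 h1 hab' h₁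
  obtain ⟨-, -, hwc, hwd⟩ := strand_meet hw hj h0 h1 hcd' h₂
  obtain ⟨rfl, rfl⟩ := (hw j).unique hab' (by rwa [Prefers, hwa, hwb]) hcd'
    (by rwa [Prefers, hwc, hwd])
  rfl

theorem strand_natCast (w : ℕ → PrefOrder A) {j : ℕ} (hj : j ≤ N) (a : A) :
    strand w N a j = -(((w j).symm a : ℕ) : ℝ) := by
  rcases hj.eq_or_lt with rfl | hj
  · exact strand_of_le w _ a le_rfl
  · rw [strand_eq w hj a le_rfl (by linarith)]
    simp

theorem strand_natCast_ne (w : ℕ → PrefOrder A) {j : ℕ} (hj : j ≤ N) {a b : A} (hab : a ≠ b) :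
    strand w N a j ≠ strand w N b j := by
  rw [strand_natCast w hj, strand_natCast w hj, Ne, neg_inj, Nat.cast_inj, Fin.val_inj]
  exact (w j).symm.injective.ne hab

/-- The pseudolines of a walk `w 0, …, w N` in which consecutive orders are equal or differ by an
exchange of two neighbours: each exchange is one crossing. -/
noncomputable def GeneralisedArrangement.ofWalk (hN : 0 < N)
    (hw : ∀ j, IsLazySwap (w j) (w (j + 1))) : GeneralisedArrangement A where
  line a t := strand w N a (N * t)
  continuousOn_line a := ((continuous_strand w N a).comp (by fun_prop)).continuousOn
  left_ne a b hab := by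
    simpa using strand_natCast_ne w (Nat.zero_le N) hab
  right_ne a b hab := by
    simpa using strand_natCast_ne w le_rfl hab
  finite_inter a b hab := finite_strand_meet hN hw hab
  crossing a b hab t ht heq := by
    obtain ⟨j, hj, h0, h1⟩ := exists_step hN ht
    rcases PrefOrder.prefers_or_prefers (w j) hab with h | h
    · exact .inr (strand_crossing hN hw hj h0 h1 h heq)
    · exact .inl (strand_crossing hN hw hj h0 h1 h heq.symm)
  simple a b c d hab hcd t ht h₁ h₂ _ := strand_simple hN hw hab hcd ht h₁ h₂

end OfWalk

/-! ### Chamber sets -/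

namespace GeneralisedArrangement

/-- On a connected set that avoids the lines, the height above a fixed line has constant sign. -/
theorem label_connectedComponentIn {A : Type*} (g : GeneralisedArrangement A) {p : ℝ × ℝ}
    (hp : p ∈ g.offLines) :
    g.label (connectedComponentIn g.offLines p) = {a | p.2 < g.line a p.1} := by
  ext a
  refine ⟨fun h => h p (mem_connectedComponentIn hp), fun h q hq => ?_⟩
  by_contra! hle
  have hsub := connectedComponentIn_subset g.offLines p
  have hcont : ContinuousOn (fun x : ℝ × ℝ => g.line a x.1 - x.2)
      (connectedComponentIn g.offLines p) :=
    ((g.continuousOn_line a).comp continuousOn_fst fun x hx => (hsub hx).1.1).sub continuousOn_snd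
  obtain ⟨x, hx, hx0⟩ := isPreconnected_connectedComponentIn.intermediate_value hq
    (mem_connectedComponentIn hp) hcont ⟨sub_nonpos.2 hle, sub_nonneg.2 (le_of_lt h)⟩
  exact (hsub hx).2 (mem_iUnion.2 ⟨a, (sub_eq_zero.1 hx0).symm⟩)

theorem mem_chamberSets_iff {A : Type*} (g : GeneralisedArrangement A) {X : Set A} :
    X ∈ g.chamberSets ↔ ∃ p ∈ g.offLines, X = {a | p.2 < g.line a p.1} := by
  constructor
  · rintro ⟨C, ⟨p, hp, rfl⟩, rfl⟩
    exact ⟨p, hp, g.label_connectedComponentIn hp⟩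
  · rintro ⟨p, hp, rfl⟩
    exact ⟨_, ⟨p, hp, rfl⟩, (g.label_connectedComponentIn hp).symm⟩

variable {A : Type*} [Fintype A] {w : ℕ → PrefOrder A} {N : ℕ}

theorem _root_.PrefOrder.mem_flag {v : PrefOrder A} {k : Fin (Fintype.card A + 1)} {a : A} :
    a ∈ v.flag k ↔ (v.symm a : ℕ) < k := by
  rw [PrefOrder.flag, Equiv.image_eq_preimage_symm]
  rfl

/-- Each order of the walk can be read off on the vertical line at its own time. -/
theorem mem_domain_ofWalk (hN : 0 < N) (hw : ∀ j, IsLazySwap (w j) (w (j + 1))) {j : ℕ}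
    (hj : j ≤ N) : w j ∈ (ofWalk hN hw).domain := by
  intro k
  have hN' : (0 : ℝ) < N := by exact_mod_cast hN
  have hline : ∀ a, (ofWalk hN hw).line a (j / N) = -(((w j).symm a : ℕ) : ℝ) := fun a => by
    rw [← strand_natCast w hj a, ofWalk]
    simp only
    rw [mul_div_cancel₀ _ hN'.ne']
  -- Positions are integers, so the height `1 / 2 - k` separates the first `k` lines from the rest.
  refine (mem_chamberSets_iff _).2 ⟨((j : ℝ) / N, 1 / 2 - k), ⟨⟨⟨by positivity, ?_⟩, trivial⟩, ?_⟩, ?_⟩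
  · exact (div_le_one hN').2 (by exact_mod_cast hj)
  · rw [mem_iUnion]
    rintro ⟨a, ha⟩
    simp only [mem_ofPred_eq, hline] at ha
    have h2 : (1 : ℝ) + 2 * (((w j).symm a : ℕ) : ℝ) = 2 * (k : ℕ) := by linarith
    have h3 : 1 + 2 * ((w j).symm a : ℕ) = 2 * (k : ℕ) := by exact_mod_cast h2
    omega
  · ext a
    simp only [PrefOrder.mem_flag, mem_ofPred_eq, hline]
    constructor
    · intro h
      have : (((w j).symm a : ℕ) : ℝ) + 1 ≤ (k : ℕ) := by exact_mod_cast h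
      linarith
    · intro h
      by_contra! hk
      have : ((k : ℕ) : ℝ) ≤ (((w j).symm a : ℕ) : ℝ) := by exact_mod_cast hk
      linarith

theorem exists_sorted_ofWalk (hN : 0 < N) (hw : ∀ j, IsLazySwap (w j) (w (j + 1))) {t : ℝ}
    (ht : t ∈ Icc (0 : ℝ) 1) : ∃ j, ∀ a b, (w j).Prefers a b →
      (ofWalk hN hw).line b t ≤ (ofWalk hN hw).line a t := by
  obtain ⟨j, hj, h0, h1⟩ := exists_step hN ht
  obtain ⟨u, hu, hsort⟩ := (hw j).exists_sorted (τ := N * t - j) (by linarith) (by linarith)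
  have key : ∀ a b, u.Prefers a b → (ofWalk hN hw).line b t ≤ (ofWalk hN hw).line a t := by
    intro a b hab
    simp only [ofWalk]
    rw [strand_eq w hj a h0 h1, strand_eq w hj b h0 h1]
    exact neg_le_neg (hsort a b hab)
  rcases hu with rfl | rfl
  · exact ⟨_, key⟩
  · exact ⟨_, key⟩

/-- If `v` ranks `z` below `x` and `y`, the flag of `v` ending right above `z` is the label of a
point, and the lines over that point are sorted by an order of the walk. -/
theorem domain_ofWalk_subset {D : Set (PrefOrder A)} (hD : IsSaturated D) (hN : 0 < N)
    (hw : ∀ j, IsLazySwap (w j) (w (j + 1))) (hwD : ∀ j, w j ∈ D) :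
    (ofWalk hN hw).domain ⊆ D := by
  intro v hv
  refine hD v fun x y z hx hy => ?_
  obtain ⟨p, hp, hX⟩ := (mem_chamberSets_iff _).1 (hv (v.symm z).castSucc)
  obtain ⟨j, hj⟩ := exists_sorted_ofWalk hN hw hp.1.1
  have mem : ∀ a, v.Prefers a z ↔ p.2 < (ofWalk hN hw).line a p.1 := fun a => by
    have := Set.ext_iff.1 hX a
    rwa [PrefOrder.mem_flag] at this
  have key : ∀ a, v.Prefers a z → (w j).Prefers a z := by
    intro a ha
    have hne : a ≠ z := by rintro rfl; exact lt_irrefl _ ha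
    refine (PrefOrder.prefers_or_prefers (w j) hne).resolve_right fun hza => ?_
    exact lt_irrefl (v.symm z) ((mem z).2 (((mem a).1 ha).trans_le (hj z a hza)))
  exact ⟨w j, hwD j, key x hx, key y hy⟩

end GeneralisedArrangement

/-! ### Representability -/

theorem isArrowSinglePeaked_singleton {A : Type*} [Fintype A] (v : PrefOrder A) :
    IsArrowSinglePeaked {v} := by
  intro S hS
  obtain ⟨x, hx, m, hm, -, -, hxm, -⟩ := exists_lt_lt_of_card_eq_three hS v
  exact isSinglePeakedOn_of_never_last hS hx fun w hw => ⟨m, hm, by rwa [mem_singleton_iff.1 hw]⟩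

theorem nonempty_of_maximal {A : Type*} [Fintype A] {D : Set (PrefOrder A)}
    (hD : Maximal (fun D' : Set (PrefOrder A) => IsCondorcetDomain D' ∧ IsArrowSinglePeaked D') D) :
    D.Nonempty := by
  rw [nonempty_iff_ne_empty]
  rintro rfl
  have h := isArrowSinglePeaked_singleton (Fintype.equivFin A).symm
  exact hD.le_of_ge ⟨h.isCondorcetDomain, h⟩ (empty_subset _) (mem_singleton _)

/-- A nonempty saturated domain is exhausted by a sequence of its orders in which consecutive ones
are equal or differ by an exchange of two neighbours. -/
theorem IsSaturated.exists_walk {A : Type*} [Fintype A] {D : Set (PrefOrder A)}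
    (hD : IsSaturated D) (hne : D.Nonempty) :
    ∃ (w : ℕ → PrefOrder A) (N : ℕ), 0 < N ∧ (∀ j, IsLazySwap (w j) (w (j + 1))) ∧
      (∀ j, w j ∈ D) ∧ ∀ v ∈ D, ∃ j ≤ N, w j = v := by
  classical
  obtain ⟨u, hu⟩ := hne
  obtain ⟨v, p, hp⟩ := hD.preconnected_swapGraph.exists_walk_forall_mem_support ⟨u, hu⟩
    (Finset.univ : Finset D)
  refine ⟨fun j => p.getVert j, p.length + 1, Nat.succ_pos _, fun j => ?_,
    fun j => (p.getVert j).2, fun v hv => ?_⟩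
  · rcases lt_or_ge j p.length with hj | hj
    · exact .inr (p.adj_getVert_succ hj)
    · left
      simp only
      rw [p.getVert_of_length_le hj, p.getVert_of_length_le (hj.trans (Nat.le_succ j))]
  · obtain ⟨j, hj, hle⟩ := SimpleGraph.Walk.mem_support_iff_exists_getVert.1
      (hp ⟨v, hv⟩ (Finset.mem_univ _))
    exact ⟨j, hle.trans (Nat.le_succ _), congrArg Subtype.val hj⟩

theorem mainTheorem2 {A : Type*} [Fintype A] (D : Set (PrefOrder A))
    (hD : Maximal (fun D' : Set (PrefOrder A) => IsCondorcetDomain D' ∧ IsArrowSinglePeaked D') D) :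
    ∃ g : GeneralisedArrangement A, D = g.domain := by
  have hsat := isSaturated_of_maximal hD
  obtain ⟨w, N, hN, hw, hwD, hcover⟩ := hsat.exists_walk (nonempty_of_maximal hD)
  refine ⟨.ofWalk hN hw, Subset.antisymm (fun v hv => ?_)
    (GeneralisedArrangement.domain_ofWalk_subset hsat hN hw hwD)⟩
  obtain ⟨j, hj, rfl⟩ := hcover v hv
  exact GeneralisedArrangement.mem_domain_ofWalk hN hw hj
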